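/- Let $d\ge 4$ be an integer and let $0<\varepsilon\le 1$. There are constants $c,C>0$, depending only on $d$ and $\varepsilon$, such that for every integer $m\ge 1$ there exist a set $\mathcal P$ of $m$ points in $\mathbb R^d$ and a finite set $\Pi$ of $n$ hyperplanes in $\mathbb R^d$ with $$c\,m^{(3-3\varepsilon)/(d+1)}\le n\le C\,m^{(3-3\varepsilon)/(d+1)},$$ such that no two distinct points of $\mathcal P$ are both contained in each of $t$ distinct members of $\Pi$, for any integer $t\ge (d-1)/\varepsilon$ (the incidence graph of $\mathcal P\times\Pi$ contains no $K_{2,(d-1)/\varepsilon}$), and such that the number of incidences $I(\mathcal P,\Pi)=|\{(p,V)\in\mathcal P\times\Pi : p\in V\}|$ satisfies $$I(\mathcal P,\Pi)\ge c\, m^{(2d-2)/(2d-1)}\,n^{d/(2d-1)-\varepsilon}.$$ The same holds, with the same constants, with hyperspheres (of positive radius) in $\mathbb R^d$ in place of hyperplanes, and with members of $F$ in place of hyperplanes for every non-empty linearly-closed family $F$ of graphs in $\mathbb R^d$. Here a graph is a set $\{x\in\mathbb R^d : x_d=f(x_1,\ldots,x_{d-1})\}$ with $f:\mathbb R^{d-1}\to\mathbb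 R$ an arbitrary function, and a family $F$ of graphs is linearly-closed if, whenever the graph of $f$ is in $F$, so is the graph of $f(x_1,\ldots,x_{d-1})+a_1x_1+\cdots+a_{d-1}x_{d-1}+a_d$ for all $a_1,\ldots,a_d\in\mathbb R$. -/

import Mathlib

/-- A hyperplane in `ℝ^d`: the solution set of one non-trivial linear equation. -/
def IsHyperplane {d : ℕ} (V : Set (EuclideanSpace ℝ (Fin d))) : Prop :=
  ∃ a : EuclideanSpace ℝ (Fin d), a ≠ 0 ∧ ∃ b : ℝ, V = {x | inner ℝ a x = b}

/-- A hypersphere in `ℝ^d`, of positive radius. -/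
def IsHypersphere {d : ℕ} (V : Set (EuclideanSpace ℝ (Fin d))) : Prop :=
  ∃ z : EuclideanSpace ℝ (Fin d), ∃ r : ℝ, 0 < r ∧ V = Metric.sphere z r

/-- The graph in `ℝ^d` defined by `x_d = f (x_1, …, x_{d-1})`, for an arbitrary function `f`. -/
def hypersurfaceGraph {d : ℕ} (hd : 0 < d) (f : (Fin (d - 1) → ℝ) → ℝ) :
    Set (EuclideanSpace ℝ (Fin d)) :=
  {x | x ⟨d - 1, Nat.sub_lt hd Nat.one_pos⟩ = f (fun i => x (i.castLE (Nat.sub_le d 1)))}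

/-- A linearly-closed family: every member is a graph, and the family is closed under adding
an affine function `a_1 x_1 + ⋯ + a_{d-1} x_{d-1} + a_d` to the defining function. -/
def IsLinearlyClosed {d : ℕ} (hd : 0 < d) (F : Set (Set (EuclideanSpace ℝ (Fin d)))) : Prop :=
  (∀ V ∈ F, ∃ f : (Fin (d - 1) → ℝ) → ℝ, V = hypersurfaceGraph hd f) ∧
  ∀ f : (Fin (d - 1) → ℝ) → ℝ, hypersurfaceGraph hd f ∈ F →
    ∀ (a : Fin (d - 1) → ℝ) (b : ℝ),
      hypersurfaceGraph hd (fun x => f x + ∑ i, a i * x i + b) ∈ F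

open Classical in
/-- The number of incidences: pairs `(p, V)` of a point and an object with `p ∈ V`. -/
noncomputable def incidenceCount {X : Type*} (P : Finset X) (H : Finset (Set X)) : ℕ :=
  ((P ×ˢ H).filter (fun q => q.1 ∈ q.2)).card

/-- The incidence graph of `P × H` contains a copy of `K_{s,t}`: there are `s` points of `P`
all of which lie on each of some `t` objects of `H`. -/
def IncidenceGraphContains {X : Type*} (P : Finset X) (H : Finset (Set X)) (s t : ℕ) : Prop :=
  ∃ A ⊆ P, ∃ B ⊆ H, A.card = s ∧ B.card = t ∧ ∀ p ∈ A, ∀ V ∈ B, p ∈ V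

/-- There are `m` points and `n` objects from the family `F` in `ℝ^d`, where `n` is between
`c` and `C` times `m^((3-3ε)/(d+1))`, with no `K_{2,t}` in the incidence graph for any integer
`t ≥ (d-1)/ε`, and with at least `c m^((2d-2)/(2d-1)) n^(d/(2d-1)-ε)` incidences. -/
def HasConfiguration (d : ℕ) (ε c C : ℝ) (m : ℕ)
    (F : Set (Set (EuclideanSpace ℝ (Fin d)))) : Prop :=
  ∃ (P : Finset (EuclideanSpace ℝ (Fin d))) (H : Finset (Set (EuclideanSpace ℝ (Fin d)))),
    P.card = m ∧
    (∀ V ∈ H, V ∈ F) ∧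
    c * (m : ℝ) ^ ((3 - 3 * ε) / ((d : ℝ) + 1)) ≤ (H.card : ℝ) ∧
    (H.card : ℝ) ≤ C * (m : ℝ) ^ ((3 - 3 * ε) / ((d : ℝ) + 1)) ∧
    (∀ t : ℕ, ((d : ℝ) - 1) / ε ≤ (t : ℝ) → ¬ IncidenceGraphContains P H 2 t) ∧
    c * ((m : ℝ) ^ ((2 * (d : ℝ) - 2) / (2 * (d : ℝ) - 1)) *
        (H.card : ℝ) ^ ((d : ℝ) / (2 * (d : ℝ) - 1) - ε)) ≤ (incidenceCount P H : ℝ)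

/-!
Consider integer points `(x, y)` and hyperplanes `y = ∑ aᵢ xᵢ + b`, with `K = d - 1` variables `xᵢ`.
Let `p` be a prime and let the direction `a` run over `s ≤ p` points of the moment curve
`(j, j², …, j^K)` reduced modulo `p` into `{0, …, p-1}^K`. Two distinct points with
`x, x' ∈ {0, …, p-1}^K` that lie on a common hyperplane satisfy `a · (x - x') = y - y'` with
`x ≢ x'` modulo `p`. This is a hyperplane modulo `p`, which meets the moment curve in at most `K`
points, and `b` is determined by `a`; so the incidence graph contains no `K_{2,d}`
(`card_common_momentPlanes_le`). With `y` in an interval of length about `p²` and all `b` of that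
order there are about `p^(d+1)` points and `s p²` hyperplanes, and every point lies on one hyperplane
in each of the `s` directions (`le_card_filter_momentPlanes`).

For `ε < 1/3` take `p` about `M = m^(1/(d+1))` (Bertrand's postulate) and `s` about `M^(1-3ε)`. This
gives `n` about `M^(3-3ε)` and `m s` incidences, as many as required because the exponent of `M`
in the required bound falls short of the one in `m s` by `3ε (d/(2d-1) - ε) ≥ 0`. Since
`(d-1)/ε ≥ d`, the absence of `K_{2,d}` is enough. For `ε ≥ 1/3` the required number of incidences
is at most of order `m`, and parallel hyperplanes with all points on one of them suffice.

Only the incidence pattern of lattice points and lattice hyperplanes matters, so a family that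
reproduces it (`Realizes`) inherits the configuration. For a linearly-closed family with a member
given by `f`, send `(x, y)` to `(x, f x + y)` and `(a, b)` to the graph of `f + a · x + b`.
For hyperspheres, invert about the origin, which lies on none of the hyperplanes as `b > 0`.
-/

/-! ### The combinatorial model -/

/-- The non-negative integer points `(x, y)` and the non-vertical hyperplanes
`y = ∑ aᵢ xᵢ + b` with non-negative integer coefficients, `h = (a, b)`, both encoded as elements
of `(Fin K → ℕ) × ℕ`; this is the relation "the point `p` lies on the hyperplane `h`". -/
def LatticeIncident {K : ℕ} (p h : (Fin K → ℕ) × ℕ) : Prop :=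
  p.2 = ∑ i, h.1 i * p.1 i + h.2

/-- The lattice incidence relation, restricted to points with `0 < y` and hyperplanes with
`0 < b`, embeds into the incidence relation between `ℝ^d` and the family `F`. Positivity keeps
the origin off all points and hyperplanes, so that inversion may be applied. -/
def Realizes {d : ℕ} (K : ℕ) (F : Set (Set (EuclideanSpace ℝ (Fin d)))) : Prop :=
  ∃ (φ : (Fin K → ℕ) × ℕ → EuclideanSpace ℝ (Fin d))
    (ψ : (Fin K → ℕ) × ℕ → Set (EuclideanSpace ℝ (Fin d))),
    Set.InjOn φ {p | 0 < p.2} ∧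
    ∀ h, 0 < h.2 → ψ h ∈ F ∧ ∀ p, 0 < p.2 → (φ p ∈ ψ h ↔ LatticeIncident p h)

/-- A lattice hyperplane is determined by its lattice points; hence the map of hyperplanes in
`Realizes` is automatically injective. -/
theorem LatticeIncident.ext_of_forall {K : ℕ} {h h' : (Fin K → ℕ) × ℕ} (hb : 0 < h.2)
    (H : ∀ p : (Fin K → ℕ) × ℕ, 0 < p.2 → LatticeIncident p h → LatticeIncident p h') :
    h = h' := by
  have h0 : h.2 = h'.2 := by
    have := H (0, h.2) hb (by simp [LatticeIncident])
    simpa [LatticeIncident] using this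
  refine Prod.ext (funext fun i => ?_) h0
  have := H (Pi.single i 1, h.1 i + h.2) (by simp; omega)
    (by simp [LatticeIncident, Pi.single_apply])
  simp only [LatticeIncident, Pi.single_apply, mul_ite, mul_one, mul_zero,
    Finset.sum_ite_eq', Finset.mem_univ, if_true] at this
  omega

open Classical in
/-- Transfer of a lattice configuration in which every point has degree at least `s` and any two
points have fewer than `t₀` common hyperplanes to a family realizing lattice incidences. -/
theorem Realizes.hasConfiguration {d K : ℕ} {F : Set (Set (EuclideanSpace ℝ (Fin d)))}
    (hF : Realizes K F) {ε c C : ℝ} {m s t₀ : ℕ} (P H : Finset ((Fin K → ℕ) × ℕ))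
    (hP : P.card = m) (hP0 : ∀ p ∈ P, 0 < p.2) (hH0 : ∀ h ∈ H, 0 < h.2)
    (hdeg : ∀ p ∈ P, s ≤ (H.filter (LatticeIncident p)).card)
    (hco : ∀ p ∈ P, ∀ q ∈ P, p ≠ q →
      (H.filter fun h => LatticeIncident p h ∧ LatticeIncident q h).card < t₀)
    (ht : (t₀ : ℝ) ≤ ((d : ℝ) - 1) / ε)
    (hlow : c * (m : ℝ) ^ ((3 - 3 * ε) / ((d : ℝ) + 1)) ≤ (H.card : ℝ))
    (hupp : (H.card : ℝ) ≤ C * (m : ℝ) ^ ((3 - 3 * ε) / ((d : ℝ) + 1)))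
    (hinc : c * ((m : ℝ) ^ ((2 * (d : ℝ) - 2) / (2 * (d : ℝ) - 1)) *
      (H.card : ℝ) ^ ((d : ℝ) / (2 * (d : ℝ) - 1) - ε)) ≤ (m : ℝ) * s) :
    HasConfiguration d ε c C m F := by
  obtain ⟨φ, ψ, hφ, hψ⟩ := hF
  have hφP : Set.InjOn φ P := fun p hp q hq => hφ (hP0 p hp) (hP0 q hq)
  have hψH : Set.InjOn ψ H := by
    intro h hh h' hh' e
    refine LatticeIncident.ext_of_forall (hH0 h hh) fun p hp hi => ?_
    rw [← (hψ h' (hH0 h' hh')).2 p hp, ← e, (hψ h (hH0 h hh)).2 p hp]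
    exact hi
  have hcard : (H.image ψ).card = H.card := Finset.card_image_of_injOn hψH
  have hmem : ∀ p ∈ P, ∀ h ∈ H, (φ p ∈ ψ h ↔ LatticeIncident p h) := fun p hp h hh =>
    (hψ h (hH0 h hh)).2 p (hP0 p hp)
  refine ⟨P.image φ, H.image ψ, ?_, ?_, ?_, ?_, ?_, ?_⟩
  · rw [Finset.card_image_of_injOn hφP, hP]
  · intro V hV
    obtain ⟨h, hh, rfl⟩ := Finset.mem_image.1 hV
    exact (hψ h (hH0 h hh)).1
  · rwa [hcard]
  · rwa [hcard]
  · rintro t htt ⟨A, hA, B, hB, hA2, hBt, hAB⟩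
    obtain ⟨a, b, hab, rfl⟩ := Finset.card_eq_two.1 hA2
    obtain ⟨p, hp, rfl⟩ := Finset.mem_image.1 (hA (Finset.mem_insert_self a {b}))
    obtain ⟨q, hq, rfl⟩ := Finset.mem_image.1
      (hA (Finset.mem_insert_of_mem (Finset.mem_singleton_self b)))
    have hpq : p ≠ q := fun e => hab (by rw [e])
    have hsub : B ⊆ (H.filter fun h => LatticeIncident p h ∧ LatticeIncident q h).image ψ := by
      intro V hV
      obtain ⟨h, hh, rfl⟩ := Finset.mem_image.1 (hB hV)
      refine Finset.mem_image_of_mem _ (Finset.mem_filter.2 ⟨hh, ?_, ?_⟩)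
      · exact (hmem p hp h hh).1 (hAB _ (by simp) _ hV)
      · exact (hmem q hq h hh).1 (hAB _ (by simp) _ hV)
    have h1 := (Finset.card_le_card hsub).trans Finset.card_image_le
    have h2 : t₀ ≤ t := by exact_mod_cast ht.trans htt
    have h3 := hco p hp q hq hpq
    omega
  · rw [hcard]
    refine hinc.trans ?_
    have h1 : ∑ p ∈ P, (H.filter (LatticeIncident p)).card ≤
        incidenceCount (P.image φ) (H.image ψ) := by
      rw [← Finset.card_sigma]
      refine Finset.card_le_card_of_injOn (fun x => (φ x.1, ψ x.2)) ?_ ?_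
      · rintro ⟨p, h⟩ hx
        simp only [Finset.coe_sigma, Set.mem_sigma_iff, Finset.mem_coe, Finset.mem_filter] at hx
        simp only [Finset.mem_coe, Finset.mem_filter, Finset.mem_product]
        exact ⟨⟨Finset.mem_image_of_mem _ hx.1, Finset.mem_image_of_mem _ hx.2.1⟩,
          (hmem p hx.1 h hx.2.1).2 hx.2.2⟩
      · rintro ⟨p, h⟩ hx ⟨q, h'⟩ hy e
        simp only [Finset.coe_sigma, Set.mem_sigma_iff, Finset.mem_coe, Finset.mem_filter]
          at hx hy
        simp only [Prod.mk.injEq] at e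
        obtain rfl := hφP hx.1 hy.1 e.1
        obtain rfl := hψH hx.2.1 hy.2.1 e.2
        rfl
    have h2 : m * s ≤ ∑ p ∈ P, (H.filter (LatticeIncident p)).card := by
      rw [← hP, ← smul_eq_mul]
      exact Finset.card_nsmul_le_sum _ _ _ hdeg
    exact_mod_cast h2.trans h1

/-! ### Realizing lattice incidences by graphs, hyperplanes and hyperspheres -/

theorem sum_fin_eq_sum_castLE_add {d : ℕ} (hd : 0 < d) (g : Fin d → ℝ) :
    ∑ i, g i = ∑ i : Fin (d - 1), g (i.castLE (Nat.sub_le d 1)) +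
      g ⟨d - 1, Nat.sub_lt hd Nat.one_pos⟩ := by
  obtain ⟨k, rfl⟩ : ∃ k, d = k + 1 := ⟨d - 1, by omega⟩
  exact Fin.sum_univ_castSucc g

/-- The vector of `ℝ^d` with first coordinates `x` and last coordinate `y`. -/
noncomputable def snocVec {d : ℕ} (x : Fin (d - 1) → ℝ) (y : ℝ) : EuclideanSpace ℝ (Fin d) :=
  WithLp.toLp 2 fun i => if h : i.1 < d - 1 then x ⟨i.1, h⟩ else y

theorem snocVec_castLE {d : ℕ} (x : Fin (d - 1) → ℝ) (y : ℝ) (i : Fin (d - 1)) :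
    snocVec x y (i.castLE (Nat.sub_le d 1)) = x i := by
  simp [snocVec]

theorem snocVec_last {d : ℕ} (hd : 0 < d) (x : Fin (d - 1) → ℝ) (y : ℝ) :
    snocVec x y ⟨d - 1, Nat.sub_lt hd Nat.one_pos⟩ = y := by
  simp [snocVec]

theorem inner_snocVec_left {d : ℕ} (hd : 0 < d) (x : Fin (d - 1) → ℝ) (y : ℝ)
    (v : EuclideanSpace ℝ (Fin d)) :
    inner ℝ (snocVec x y) v = ∑ i, x i * v (i.castLE (Nat.sub_le d 1)) +
      y * v ⟨d - 1, Nat.sub_lt hd Nat.one_pos⟩ := by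
  rw [PiLp.inner_apply, sum_fin_eq_sum_castLE_add hd]
  simp only [snocVec_castLE, snocVec_last hd, RCLike.inner_apply, conj_trivial]
  simp only [mul_comm]

theorem snocVec_inj {d : ℕ} (hd : 0 < d) {x x' : Fin (d - 1) → ℝ} {y y' : ℝ}
    (h : snocVec x y = snocVec x' y') : x = x' ∧ y = y' := by
  refine ⟨funext fun i => ?_, ?_⟩
  · rw [← snocVec_castLE x y i, h, snocVec_castLE]
  · rw [← snocVec_last hd x y, h, snocVec_last hd]

theorem realizes_of_isLinearlyClosed {d : ℕ} (hd : 0 < d)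
    {F : Set (Set (EuclideanSpace ℝ (Fin d)))} (hne : F.Nonempty) (hF : IsLinearlyClosed hd F) :
    Realizes (d - 1) F := by
  obtain ⟨V, hV⟩ := hne
  obtain ⟨f, rfl⟩ := hF.1 V hV
  refine ⟨fun p => snocVec (fun i => p.1 i) (f (fun i => p.1 i) + p.2),
    fun h => hypersurfaceGraph hd (fun x => f x + ∑ i, (h.1 i : ℝ) * x i + h.2), ?_, ?_⟩
  · intro p _ q _ h
    obtain ⟨h1, h2⟩ := snocVec_inj hd h
    have h3 : p.1 = q.1 := funext fun i => by exact_mod_cast congrFun h1 i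
    rw [h3] at h2
    exact Prod.ext h3 (by exact_mod_cast add_left_cancel h2)
  · refine fun h _ => ⟨hF.2 f hV _ _, fun p _ => ?_⟩
    simp only [hypersurfaceGraph, Set.mem_ofPred_eq, snocVec_castLE, snocVec_last hd,
      LatticeIncident]
    rw [add_assoc, add_right_inj]
    norm_cast

/-- On lattice points, the hyperplane `h = (a, b)` has the equation `⟨(a, -1), v⟩ = -b`. -/
theorem inner_snocVec_eq_neg_iff {d : ℕ} (hd : 0 < d) (p h : (Fin (d - 1) → ℕ) × ℕ) :
    inner ℝ (snocVec (fun i => (h.1 i : ℝ)) (-1)) (snocVec (fun i => (p.1 i : ℝ)) p.2) =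
      -(h.2 : ℝ) ↔ LatticeIncident p h := by
  rw [inner_snocVec_left hd]
  simp only [snocVec_castLE, snocVec_last hd, LatticeIncident]
  rw [← Nat.cast_inj (R := ℝ)]
  push_cast
  constructor <;> intro h <;> linarith

theorem snocVec_ne_zero {d : ℕ} (hd : 0 < d) (x : Fin (d - 1) → ℝ) {y : ℝ} (hy : y ≠ 0) :
    snocVec x y ≠ 0 := fun h => hy (by rw [← snocVec_last hd x y, h]; rfl)

theorem snocVec_natCast_injective {d : ℕ} (hd : 0 < d) : Function.Injective
    fun p : (Fin (d - 1) → ℕ) × ℕ => snocVec (d := d) (fun i => (p.1 i : ℝ)) p.2 := by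
  intro p q h
  obtain ⟨h1, h2⟩ := snocVec_inj hd h
  exact Prod.ext (funext fun i => by exact_mod_cast congrFun h1 i) (by exact_mod_cast h2)

theorem realizes_isHyperplane {d : ℕ} (hd : 0 < d) :
    Realizes (d - 1) {V : Set (EuclideanSpace ℝ (Fin d)) | IsHyperplane V} := by
  refine ⟨fun p => snocVec (fun i => p.1 i) p.2,
    fun h => {x | inner ℝ (snocVec (fun i => (h.1 i : ℝ)) (-1)) x = -(h.2 : ℝ)},
    (snocVec_natCast_injective hd).injOn, fun h _ => ⟨?_, fun p _ => ?_⟩⟩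
  · exact ⟨_, snocVec_ne_zero hd _ (by norm_num), _, rfl⟩
  · exact inner_snocVec_eq_neg_iff hd p h

/-- The inversion `v ↦ v / ‖v‖²` carries the hyperplane `⟨u, v⟩ = β`, `β ≠ 0`, to a sphere through
the origin. -/
theorem inv_normSq_smul_mem_sphere_iff {E : Type*} [NormedAddCommGroup E] [InnerProductSpace ℝ E]
    {u v : E} {β : ℝ} (hβ : β ≠ 0) (hv : v ≠ 0) :
    (‖v‖ ^ 2)⁻¹ • v ∈ Metric.sphere ((2 * β)⁻¹ • u) ‖(2 * β)⁻¹ • u‖ ↔ inner ℝ u v = β := by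
  have hn : ‖v‖ ≠ 0 := norm_ne_zero_iff.2 hv
  rw [mem_sphere_iff_norm, ← sq_eq_sq₀ (norm_nonneg _) (norm_nonneg _), norm_sub_sq_real,
    inner_smul_left, inner_smul_right, real_inner_comm, norm_smul, norm_inv, norm_pow, norm_norm]
  simp only [conj_trivial]
  rw [show ∀ a b c : ℝ, a - b + c = c ↔ a = b from fun a b c => by
    constructor <;> intro h <;> linarith]
  field_simp
  constructor <;> intro h <;> linarith

theorem realizes_isHypersphere {d : ℕ} (hd : 0 < d) :
    Realizes (d - 1) {V : Set (EuclideanSpace ℝ (Fin d)) | IsHypersphere V} := by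
  set P : (Fin (d - 1) → ℕ) × ℕ → EuclideanSpace ℝ (Fin d) :=
    fun p => snocVec (fun i => p.1 i) p.2 with hP
  set u : (Fin (d - 1) → ℕ) × ℕ → EuclideanSpace ℝ (Fin d) :=
    fun h => (2 * -(h.2 : ℝ))⁻¹ • snocVec (fun i => (h.1 i : ℝ)) (-1) with hu
  refine ⟨fun p => (‖P p‖ ^ 2)⁻¹ • P p, fun h => Metric.sphere (u h) ‖u h‖, ?_,
    fun h hh => ⟨⟨u h, ‖u h‖, norm_pos_iff.2 ?_, rfl⟩, fun p hp => ?_⟩⟩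
  · intro p hp q hq h
    have hp0 : P p ≠ 0 := snocVec_ne_zero hd _ (Nat.cast_ne_zero.2 (Nat.pos_iff_ne_zero.1 hp))
    have hq0 : P q ≠ 0 := snocVec_ne_zero hd _ (Nat.cast_ne_zero.2 (Nat.pos_iff_ne_zero.1 hq))
    -- Inversion is an involution: `v` is recovered from `w = v / ‖v‖²` as `w / ‖w‖²`.
    have key : ∀ v : EuclideanSpace ℝ (Fin d), v ≠ 0 →
        (‖(‖v‖ ^ 2)⁻¹ • v‖ ^ 2)⁻¹ • ((‖v‖ ^ 2)⁻¹ • v) = v := by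
      intro v hv
      have hn : ‖v‖ ≠ 0 := norm_ne_zero_iff.2 hv
      rw [smul_smul, norm_smul, norm_inv, norm_pow, norm_norm]
      convert one_smul ℝ v using 2
      field_simp
    refine snocVec_natCast_injective hd ?_
    change P p = P q
    simp only at h
    rw [← key _ hp0, h, key _ hq0]
  · refine smul_ne_zero (inv_ne_zero ?_) (snocVec_ne_zero hd _ (by norm_num))
    have : (h.2 : ℝ) ≠ 0 := Nat.cast_ne_zero.2 hh.ne'
    simpa using this
  · have hb : -(h.2 : ℝ) ≠ 0 := neg_ne_zero.2 (Nat.cast_ne_zero.2 hh.ne')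
    rw [← inner_snocVec_eq_neg_iff hd p h]
    exact inv_normSq_smul_mem_sphere_iff hb (snocVec_ne_zero hd _ (Nat.cast_ne_zero.2 hp.ne'))

/-! ### The moment curve modulo a prime -/

/-- The point `(j, j², …, j^K)` of the moment curve modulo `p`, lifted to `{0, …, p-1}^K`. -/
def momentPoint (p K j : ℕ) : Fin K → ℕ := fun i => j ^ (i.1 + 1) % p

/-- A hyperplane modulo `p` meets the moment curve modulo `p` in at most `K` points: these are the
roots of a non-zero polynomial of degree at most `K`. -/
theorem card_momentPoint_hyperplane_le {p K : ℕ} [Fact p.Prime] (w : Fin K → ZMod p)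
    (hw : w ≠ 0) (z : ZMod p) (S : Finset ℕ) (hS : ∀ j ∈ S, j < p)
    (h : ∀ j ∈ S, ∑ i, (momentPoint p K j i : ZMod p) * w i = z) : S.card ≤ K := by
  classical
  set f : Polynomial (ZMod p) :=
    ∑ i : Fin K, Polynomial.C (w i) * Polynomial.X ^ (i.1 + 1) - Polynomial.C z with hf
  have hcoeff : ∀ i : Fin K, f.coeff (i.1 + 1) = w i := by
    intro i
    simp only [hf, Polynomial.coeff_sub, Polynomial.finsetSum_coeff, Polynomial.coeff_C_mul,
      Polynomial.coeff_X_pow, Polynomial.coeff_C_succ, sub_zero]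
    rw [Finset.sum_eq_single i]
    · simp
    · intro j _ hj
      have : i.1 ≠ j.1 := fun e => hj (Fin.ext e.symm)
      simp [this]
    · simp
  have hf0 : f ≠ 0 := by
    intro e
    exact hw (funext fun i => by rw [← hcoeff i, e]; simp)
  have hdeg : f.natDegree ≤ K := by
    refine (Polynomial.natDegree_sub_le _ _).trans (max_le ?_ (by simp))
    refine Polynomial.natDegree_sum_le_of_forall_le _ _ fun i _ => ?_
    exact (Polynomial.natDegree_C_mul_X_pow_le _ _).trans i.2
  have hinj : Set.InjOn (fun j : ℕ => (j : ZMod p)) S := by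
    intro a ha b hb e
    have := (ZMod.natCast_eq_natCast_iff' a b p).1 e
    rwa [Nat.mod_eq_of_lt (hS a ha), Nat.mod_eq_of_lt (hS b hb)] at this
  rw [← Finset.card_image_of_injOn hinj]
  refine (Finset.card_le_card (t := f.roots.toFinset) ?_).trans
    ((Multiset.toFinset_card_le _).trans ((Polynomial.card_roots' f).trans hdeg))
  intro x hx
  obtain ⟨j, hj, rfl⟩ := Finset.mem_image.1 hx
  rw [Multiset.mem_toFinset, Polynomial.mem_roots hf0, Polynomial.IsRoot.def, hf]
  simp only [Polynomial.eval_sub, Polynomial.eval_finsetSum, Polynomial.eval_mul,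
    Polynomial.eval_C, Polynomial.eval_pow, Polynomial.eval_X]
  rw [← h j hj, sub_eq_zero]
  refine Finset.sum_congr rfl fun i _ => ?_
  simp [momentPoint, mul_comm]

/-- The hyperplanes `y = ∑ aᵢ xᵢ + b` with `a` one of the first `s` points of the moment curve
modulo `p`, and `1 ≤ b ≤ B`. -/
def momentPlanes (p K s B : ℕ) : Finset ((Fin K → ℕ) × ℕ) :=
  (Finset.range s ×ˢ Finset.Icc 1 B).image fun q => (momentPoint p K q.1, q.2)

theorem mem_momentPlanes {p K s B : ℕ} {h : (Fin K → ℕ) × ℕ} :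
    h ∈ momentPlanes p K s B ↔ ∃ j < s, 1 ≤ h.2 ∧ h.2 ≤ B ∧ h.1 = momentPoint p K j := by
  simp only [momentPlanes, Finset.mem_image, Finset.mem_product, Finset.mem_range,
    Finset.mem_Icc, Prod.exists]
  constructor
  · rintro ⟨j, b, ⟨hj, h1, h2⟩, rfl⟩
    exact ⟨j, hj, h1, h2, rfl⟩
  · rintro ⟨j, hj, h1, h2, h3⟩
    exact ⟨j, h.2, ⟨hj, h1, h2⟩, Prod.ext h3.symm rfl⟩

theorem momentPoint_injOn {p K : ℕ} (hK : 0 < K) :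
    Set.InjOn (momentPoint p K) {j | j < p} := by
  intro a ha b hb e
  have := congrFun e ⟨0, hK⟩
  simpa [momentPoint, Nat.mod_eq_of_lt (Set.mem_ofPred.1 ha),
    Nat.mod_eq_of_lt (Set.mem_ofPred.1 hb)] using this

theorem card_momentPlanes {p K s B : ℕ} (hK : 0 < K) (hs : s ≤ p) :
    (momentPlanes p K s B).card = s * B := by
  rw [momentPlanes, Finset.card_image_of_injOn]
  · simp
  · rintro ⟨a, b⟩ ha ⟨a', b'⟩ ha' e
    simp only [Finset.coe_product, Set.mem_prod, Finset.mem_coe, Finset.mem_range] at ha ha'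
    simp only [Prod.mk.injEq] at e
    exact Prod.ext (momentPoint_injOn hK (ha.1.trans_le hs) (ha'.1.trans_le hs) e.1) e.2

open Classical in
/-- Two lattice points whose first coordinates are less than `p` are on at most `K` common
hyperplanes of `momentPlanes`. -/
theorem card_common_momentPlanes_le {p K s B : ℕ} (hp : p.Prime) (hs : s ≤ p)
    {u v : (Fin K → ℕ) × ℕ} (hu : ∀ i, u.1 i < p) (hv : ∀ i, v.1 i < p) (huv : u ≠ v) :
    ((momentPlanes p K s B).filter fun h => LatticeIncident u h ∧ LatticeIncident v h).card
      ≤ K := by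
  have : Fact p.Prime := ⟨hp⟩
  set T := (momentPlanes p K s B).filter fun h => LatticeIncident u h ∧ LatticeIncident v h
  set S := (Finset.range s).filter fun j =>
    ∃ b, LatticeIncident u (momentPoint p K j, b) ∧ LatticeIncident v (momentPoint p K j, b)
  by_cases hx : u.1 = v.1
  · -- Points on a common vertical line have no common non-vertical hyperplane.
    have : T = ∅ := by
      refine Finset.filter_eq_empty_iff.2 ?_
      rintro h _ ⟨h1, h2⟩
      refine huv (Prod.ext hx ?_)
      rw [LatticeIncident] at h1 h2
      rw [h1, h2, hx]
    simp [this]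
  have hTS : T ⊆ S.image fun j =>
      (momentPoint p K j, u.2 - ∑ i, momentPoint p K j i * u.1 i) := by
    intro h hh
    obtain ⟨hh1, h1, h2⟩ := Finset.mem_filter.1 hh
    obtain ⟨j, hj, _, _, e⟩ := mem_momentPlanes.1 hh1
    obtain ⟨a, b⟩ := h
    obtain rfl : a = momentPoint p K j := e
    refine Finset.mem_image.2 ⟨j, Finset.mem_filter.2 ⟨Finset.mem_range.2 hj, b, h1, h2⟩, ?_⟩
    rw [LatticeIncident] at h1
    simp only at h1
    rw [h1, Nat.add_sub_cancel_left]
  refine (Finset.card_le_card hTS).trans (Finset.card_image_le.trans ?_)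
  refine card_momentPoint_hyperplane_le (p := p) (fun i => (u.1 i : ZMod p) - v.1 i) ?_
    ((u.2 : ZMod p) - v.2) S ?_ ?_
  · intro e
    refine hx (funext fun i => ?_)
    have := sub_eq_zero.1 (congrFun e i)
    have := (ZMod.natCast_eq_natCast_iff' _ _ p).1 this
    rwa [Nat.mod_eq_of_lt (hu i), Nat.mod_eq_of_lt (hv i)] at this
  · intro j hj
    exact (Finset.mem_range.1 (Finset.mem_filter.1 hj).1).trans_le hs
  · intro j hj
    obtain ⟨b, h1, h2⟩ := (Finset.mem_filter.1 hj).2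
    rw [LatticeIncident] at h1 h2
    simp only at h1 h2
    rw [h1, h2]
    push_cast
    simp only [mul_sub, Finset.sum_sub_distrib]
    ring

/-- The box of lattice points `(x, y)` with `x ∈ {0, …, p-1}^K` and `K p² < y ≤ 2 K p²`. -/
def latticeBox (p K : ℕ) : Finset ((Fin K → ℕ) × ℕ) :=
  (Fintype.piFinset fun _ => Finset.range p) ×ˢ Finset.Ioc (K * p ^ 2) (2 * K * p ^ 2)

theorem card_latticeBox (p K : ℕ) : (latticeBox p K).card = K * p ^ (K + 2) := by
  simp only [latticeBox, Finset.card_product, Fintype.card_piFinset, Finset.card_range,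
    Finset.prod_const, Finset.card_univ, Fintype.card_fin, Nat.card_Ioc]
  rw [show 2 * K * p ^ 2 - K * p ^ 2 = K * p ^ 2 by rw [mul_assoc, two_mul, Nat.add_sub_cancel]]
  ring

open Classical in
/-- Each point of the box is on one plane of `momentPlanes` in each of the `s` directions. -/
theorem le_card_filter_momentPlanes {p K s : ℕ} (hp : 0 < p) (hK : 0 < K) (hs : s ≤ p)
    {u : (Fin K → ℕ) × ℕ} (hu : u ∈ latticeBox p K) :
    s ≤ ((momentPlanes p K s (2 * K * p ^ 2)).filter (LatticeIncident u)).card := by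
  simp only [latticeBox, Finset.mem_product, Fintype.mem_piFinset, Finset.mem_range,
    Finset.mem_Ioc] at hu
  obtain ⟨hx, hy1, hy2⟩ := hu
  have hsum : ∀ j, ∑ i, momentPoint p K j i * u.1 i ≤ K * p ^ 2 := by
    intro j
    calc ∑ i, momentPoint p K j i * u.1 i ≤ ∑ _i : Fin K, p * p :=
          Finset.sum_le_sum fun i _ => Nat.mul_le_mul (Nat.mod_lt _ hp).le (hx i).le
      _ = K * p ^ 2 := by simp [sq]
  conv_lhs => rw [← Finset.card_range s]
  refine Finset.card_le_card_of_injOn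
    (fun j => (momentPoint p K j, u.2 - ∑ i, momentPoint p K j i * u.1 i)) ?_ ?_
  · intro j hj
    have hj' := Finset.mem_range.1 (Finset.mem_coe.1 hj)
    have := hsum j
    refine Finset.mem_coe.2 (Finset.mem_filter.2 ⟨mem_momentPlanes.2 ⟨j, hj', ?_, ?_, rfl⟩, ?_⟩)
    · simp only
      omega
    · simp only
      omega
    · simp only [LatticeIncident]
      omega
  · intro a ha b hb e
    have ha' := Finset.mem_range.1 (Finset.mem_coe.1 ha)
    have hb' := Finset.mem_range.1 (Finset.mem_coe.1 hb)
    exact momentPoint_injOn hK (ha'.trans_le hs) (hb'.trans_le hs) (Prod.mk.inj e).1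

/-! ### Choice of parameters -/

/-- For `ε < 1/3` the moment-curve configuration with about `m^((1-3ε)/(d+1))` directions works. -/
theorem hasConfiguration_of_lt_third {d : ℕ} (hd : 4 ≤ d) {ε : ℝ} (hε : 0 < ε) (hε3 : ε < 1 / 3)
    {m : ℕ} (hm : 1 ≤ m) {F : Set (Set (EuclideanSpace ℝ (Fin d)))} (hF : Realizes (d - 1) F) :
    HasConfiguration d ε (1 / (64 * d)) (64 * d) m F := by
  have hdR : (4 : ℝ) ≤ d := by exact_mod_cast hd
  have hmR : (1 : ℝ) ≤ m := by exact_mod_cast hm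
  have hm0 : (0 : ℝ) ≤ m := by linarith
  set K := d - 1 with hK
  have hKd : d = K + 1 := by omega
  have hKR : (K : ℝ) = d - 1 := by rw [hKd]; push_cast; ring
  set M : ℝ := (m : ℝ) ^ (1 / ((d : ℝ) + 1)) with hM
  have hM1 : 1 ≤ M := Real.one_le_rpow hmR (by positivity)
  have hM0 : 0 < M := by linarith
  have hMpow : ∀ x : ℝ, M ^ x = (m : ℝ) ^ (x / ((d : ℝ) + 1)) := by
    intro x
    rw [hM, ← Real.rpow_mul hm0]
    congr 1
    ring
  have hMm : M ^ (d + 1) = m := by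
    rw [← Real.rpow_natCast, hMpow]
    push_cast
    rw [div_self (by positivity), Real.rpow_one]
  obtain ⟨p, hp, hqp, hp2⟩ := Nat.exists_prime_lt_and_le_two_mul ⌈M⌉₊
    (Nat.ceil_pos.2 hM0).ne'
  have hpM : M ≤ p := (Nat.le_ceil M).trans (by exact_mod_cast hqp.le)
  have hp4 : (p : ℝ) ≤ 4 * M := by
    have h1 : (p : ℝ) ≤ 2 * (⌈M⌉₊ : ℝ) := by exact_mod_cast hp2
    have h2 := (Nat.ceil_lt_add_one hM0.le).le
    linarith
  set N : ℝ := M ^ (1 - 3 * ε) with hN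
  have hN1 : 1 ≤ N := Real.one_le_rpow hM1 (by linarith)
  have hNM : N ≤ M := by
    calc N ≤ M ^ (1 : ℝ) := Real.rpow_le_rpow_of_exponent_le hM1 (by linarith)
      _ = M := Real.rpow_one M
  set s := ⌈N⌉₊ with hs
  have hNs : N ≤ s := Nat.le_ceil N
  have hs2 : (s : ℝ) ≤ 2 * N := by
    have := (Nat.ceil_lt_add_one (show (0 : ℝ) ≤ N by linarith)).le
    linarith
  have hsp : s ≤ p := (Nat.ceil_mono hNM).trans hqp.le
  have hcardm : m ≤ (latticeBox p K).card := by
    rw [card_latticeBox]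
    have h1 : m ≤ p ^ (K + 2) := by
      have : (m : ℝ) ≤ (p : ℝ) ^ (d + 1) := by
        rw [← hMm]
        gcongr
      rw [hKd] at this
      exact_mod_cast this
    exact h1.trans (Nat.le_mul_of_pos_left _ (by omega))
  obtain ⟨P, hPsub, hPm⟩ := Finset.exists_subset_card_eq hcardm
  have hPx : ∀ u ∈ P, ∀ i, u.1 i < p := by
    intro u hu i
    have := hPsub hu
    simp only [latticeBox, Finset.mem_product, Fintype.mem_piFinset, Finset.mem_range] at this
    exact this.1 i
  have hn : ((momentPlanes p K s (2 * K * p ^ 2)).card : ℝ) = s * (2 * (d - 1) * p ^ 2) := by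
    rw [card_momentPlanes (by omega) hsp]
    push_cast
    rw [hKR]
  -- The prescribed number of hyperplanes is `N M²`.
  have hNM2 : (m : ℝ) ^ ((3 - 3 * ε) / ((d : ℝ) + 1)) = N * M ^ 2 := by
    rw [← hMpow, hN, ← Real.rpow_natCast, ← Real.rpow_add hM0]
    congr 1
    push_cast
    ring
  have hupper : ((momentPlanes p K s (2 * K * p ^ 2)).card : ℝ) ≤ 64 * d * (N * M ^ 2) := by
    rw [hn]
    calc (s : ℝ) * (2 * (d - 1) * p ^ 2) ≤ (2 * N) * (2 * d * (4 * M) ^ 2) := by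
          gcongr
          · nlinarith
          · linarith
      _ = 64 * d * (N * M ^ 2) := by ring
  refine hF.hasConfiguration (s := s) (t₀ := d) P (momentPlanes p K s (2 * K * p ^ 2)) hPm
    ?_ ?_ ?_ ?_ ?_ ?_ ?_ ?_
  · intro u hu
    have := hPsub hu
    simp only [latticeBox, Finset.mem_product, Finset.mem_Ioc] at this
    omega
  · intro h hh
    obtain ⟨_, _, h1, _⟩ := mem_momentPlanes.1 hh
    exact h1
  · exact fun u hu => le_card_filter_momentPlanes hp.pos (by omega) hsp (hPsub hu)
  · intro u hu v hv huv
    have := card_common_momentPlanes_le (B := 2 * K * p ^ 2) hp hsp (hPx u hu) (hPx v hv) huv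
    omega
  · rw [le_div_iff₀ hε]
    nlinarith
  · rw [hNM2, hn]
    calc 1 / (64 * (d : ℝ)) * (N * M ^ 2) ≤ 1 * (N * M ^ 2) := by
          gcongr
          rw [div_le_one (by positivity)]
          linarith
      _ = N * (1 * M ^ 2) := by ring
      _ ≤ s * (2 * (d - 1) * p ^ 2) := by
          gcongr <;> linarith
  · rw [hNM2]
    exact hupper
  · set e : ℝ := (d : ℝ) / (2 * (d : ℝ) - 1) - ε with he
    have h2d : 0 < 2 * (d : ℝ) - 1 := by linarith
    have hhalf : 1 / 2 < (d : ℝ) / (2 * (d : ℝ) - 1) := by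
      rw [lt_div_iff₀ h2d]
      linarith
    have hle1 : (d : ℝ) / (2 * (d : ℝ) - 1) ≤ 1 := by
      rw [div_le_one h2d]
      linarith
    have he0 : 0 ≤ e := by rw [he]; linarith
    have he1 : e ≤ 1 := by rw [he]; linarith
    have hNM0 : 0 ≤ N * M ^ 2 := by positivity
    -- The power of `M` on the left is at most `1 - 3ε`; the difference is `3ε (d/(2d-1) - ε)`.
    have hexp : (2 * (d : ℝ) - 2) / (2 * (d : ℝ) - 1) * (d + 1) + (3 - 3 * ε) * e
        ≤ (d + 1) + (1 - 3 * ε) := by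
      have h3 : (2 * (d : ℝ) - 2) / (2 * (d : ℝ) - 1) = 1 - 1 / (2 * d - 1) := by
        field_simp
        ring
      have h4 : 1 / (2 * (d : ℝ) - 1) * (d + 1) = 3 * (d / (2 * d - 1)) - 1 := by
        field_simp
        ring
      rw [h3, sub_mul, h4, he]
      nlinarith
    calc 1 / (64 * (d : ℝ)) * ((m : ℝ) ^ ((2 * (d : ℝ) - 2) / (2 * (d : ℝ) - 1)) *
          ((momentPlanes p K s (2 * K * p ^ 2)).card : ℝ) ^ e)
        ≤ 1 / (64 * (d : ℝ)) * ((m : ℝ) ^ ((2 * (d : ℝ) - 2) / (2 * (d : ℝ) - 1)) *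
          (64 * d * (N * M ^ 2)) ^ e) :=
          mul_le_mul_of_nonneg_left (mul_le_mul_of_nonneg_left
            (Real.rpow_le_rpow (Nat.cast_nonneg _) hupper he0) (by positivity)) (by positivity)
      _ = 1 / (64 * (d : ℝ)) * (64 * d) ^ e *
          ((m : ℝ) ^ ((2 * (d : ℝ) - 2) / (2 * (d : ℝ) - 1)) * (N * M ^ 2) ^ e) := by
          rw [Real.mul_rpow (by positivity) hNM0]
          ring
      _ ≤ 1 * ((m : ℝ) ^ ((2 * (d : ℝ) - 2) / (2 * (d : ℝ) - 1)) * (N * M ^ 2) ^ e) := by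
          gcongr
          rw [one_div, inv_mul_le_one₀ (by positivity)]
          calc (64 * (d : ℝ)) ^ e ≤ (64 * (d : ℝ)) ^ (1 : ℝ) :=
                Real.rpow_le_rpow_of_exponent_le (by linarith) he1
            _ = 64 * d := Real.rpow_one _
      _ = M ^ ((2 * (d : ℝ) - 2) / (2 * (d : ℝ) - 1) * (d + 1) + (3 - 3 * ε) * e) := by
          rw [one_mul, Real.rpow_add hM0, Real.rpow_mul hM0.le (3 - 3 * ε), hMpow (3 - 3 * ε),
            hNM2, hMpow (_ * _), mul_div_assoc, div_self (by positivity), mul_one]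
      _ ≤ M ^ (((d : ℝ) + 1) + (1 - 3 * ε)) := Real.rpow_le_rpow_of_exponent_le hM1 hexp
      _ = m * N := by
          rw [Real.rpow_add hM0, ← hN, hMpow ((d : ℝ) + 1), div_self (by positivity),
            Real.rpow_one]
      _ ≤ m * s := by gcongr

/-- For `ε ≥ 1/3` the incidence bound is at most linear in `m`, and parallel hyperplanes, one of
which contains all the points, suffice. -/
theorem hasConfiguration_of_third_le {d : ℕ} (hd : 4 ≤ d) {ε : ℝ} (hε3 : 1 / 3 ≤ ε) (hε1 : ε ≤ 1)
    {m : ℕ} (hm : 1 ≤ m) {F : Set (Set (EuclideanSpace ℝ (Fin d)))} (hF : Realizes (d - 1) F) :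
    HasConfiguration d ε (1 / (64 * d)) (64 * d) m F := by
  have hdR : (4 : ℝ) ≤ d := by exact_mod_cast hd
  have hmR : (1 : ℝ) ≤ m := by exact_mod_cast hm
  have h2d : 0 < 2 * (d : ℝ) - 1 := by linarith
  set α : ℝ := (3 - 3 * ε) / ((d : ℝ) + 1) with hα
  have hα0 : 0 ≤ α := div_nonneg (by linarith) (by linarith)
  set A : ℝ := (m : ℝ) ^ α with hA
  have hA1 : 1 ≤ A := Real.one_le_rpow hmR hα0
  set n := ⌈A⌉₊ with hn
  have hnA : A ≤ n := Nat.le_ceil A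
  have hn2 : (n : ℝ) ≤ 2 * A := by
    have := (Nat.ceil_lt_add_one (show (0 : ℝ) ≤ A by linarith)).le
    linarith
  have hn1 : (1 : ℝ) ≤ n := hA1.trans hnA
  have hn1' : 1 ≤ n := by exact_mod_cast hn1
  classical
  set P : Finset ((Fin (d - 1) → ℕ) × ℕ) :=
    (Finset.range m).image fun j => ((fun _ => j : Fin (d - 1) → ℕ), 1) with hP
  set H : Finset ((Fin (d - 1) → ℕ) × ℕ) :=
    (Finset.Icc 1 n).image fun b => ((0 : Fin (d - 1) → ℕ), b) with hH
  have hHcard : H.card = n := by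
    rw [hH, Finset.card_image_of_injective _ (Prod.mk_right_injective _)]
    simp
  have hc1 : 1 / (64 * (d : ℝ)) ≤ 1 := by
    rw [div_le_one (by positivity)]
    linarith
  have hle : ∀ p, (H.filter (LatticeIncident p)).card ≤ 1 := by
    refine fun p => Finset.card_le_one.2 fun a ha b hb => ?_
    obtain ⟨ha1, ha2⟩ := Finset.mem_filter.1 ha
    obtain ⟨hb1, hb2⟩ := Finset.mem_filter.1 hb
    obtain ⟨a, _, rfl⟩ := Finset.mem_image.1 ha1
    obtain ⟨b, _, rfl⟩ := Finset.mem_image.1 hb1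
    simp only [LatticeIncident, Pi.zero_apply, zero_mul, Finset.sum_const_zero, zero_add]
      at ha2 hb2
    rw [← ha2, ← hb2]
  refine hF.hasConfiguration (s := 1) (t₀ := 2) P H ?_ ?_ ?_ ?_ ?_ ?_ ?_ ?_ ?_
  · rw [hP, Finset.card_image_of_injective, Finset.card_range]
    intro a b e
    exact congrFun (Prod.mk.inj e).1 (⟨0, by omega⟩ : Fin (d - 1))
  · intro p hp
    obtain ⟨j, _, rfl⟩ := Finset.mem_image.1 hp
    exact one_pos
  · intro h hh
    obtain ⟨b, hb, rfl⟩ := Finset.mem_image.1 hh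
    exact (Finset.mem_Icc.1 hb).1
  · intro p hp
    obtain ⟨j, _, rfl⟩ := Finset.mem_image.1 hp
    refine Finset.card_pos.2 ⟨(0, 1), Finset.mem_filter.2 ⟨?_, by simp [LatticeIncident]⟩⟩
    exact Finset.mem_image_of_mem _ (Finset.mem_Icc.2 ⟨le_rfl, hn1'⟩)
  · intro p _ q _ _
    refine Nat.lt_succ_of_le ((Finset.card_le_card ?_).trans (hle p))
    exact Finset.monotone_filter_right _ fun _ _ h => h.1
  · rw [le_div_iff₀ (by linarith)]
    push_cast
    linarith
  · rw [hHcard]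
    calc 1 / (64 * (d : ℝ)) * A ≤ 1 * A := by gcongr
      _ ≤ n := by rwa [one_mul]
  · rw [hHcard]
    refine hn2.trans ?_
    gcongr
    linarith
  · rw [hHcard]
    set e : ℝ := (d : ℝ) / (2 * (d : ℝ) - 1) - ε with he
    have h3 : (2 * (d : ℝ) - 2) / (2 * (d : ℝ) - 1) = 1 - 1 / (2 * d - 1) := by
      field_simp
      ring
    -- The exponent `e` may be negative, and then `n ^ e ≤ 1`.
    have hpos : (n : ℝ) ^ e ≤ 2 * (m : ℝ) ^ (1 / (2 * (d : ℝ) - 1)) := by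
      have hm1 : (1 : ℝ) ≤ (m : ℝ) ^ (1 / (2 * (d : ℝ) - 1)) :=
        Real.one_le_rpow hmR (by positivity)
      rcases le_total e 0 with h | h
      · exact (Real.rpow_le_one_of_one_le_of_nonpos hn1 h).trans (by linarith)
      · have he1 : e ≤ 1 := by
          have : (d : ℝ) / (2 * (d : ℝ) - 1) ≤ 1 := by
            rw [div_le_one h2d]
            linarith
          linarith
        have hαe : α * e ≤ 1 / (2 * (d : ℝ) - 1) := by
          have h5 : e ≤ ((d : ℝ) + 1) * (1 / (2 * (d : ℝ) - 1)) / 3 := by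
            have : (d : ℝ) / (2 * (d : ℝ) - 1) - 1 / 3 =
                ((d : ℝ) + 1) * (1 / (2 * (d : ℝ) - 1)) / 3 := by
              have h6 := mul_one_div_cancel h2d.ne'
              rw [div_eq_mul_one_div (d : ℝ)]
              linear_combination (1 / 3) * h6
            rw [← this]
            linarith
          have h6 : α ≤ 3 / ((d : ℝ) + 1) := by
            rw [hα]
            gcongr
            linarith
          calc α * e ≤ 3 / ((d : ℝ) + 1) * (((d : ℝ) + 1) * (1 / (2 * (d : ℝ) - 1)) / 3) := by
                gcongr
            _ = 1 / (2 * (d : ℝ) - 1) := by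
                field_simp
        calc (n : ℝ) ^ e ≤ (2 * A) ^ e := by gcongr
          _ = 2 ^ e * (m : ℝ) ^ (α * e) := by
              rw [Real.mul_rpow (by norm_num) (by linarith), hA, ← Real.rpow_mul (by linarith)]
          _ ≤ 2 ^ (1 : ℝ) * (m : ℝ) ^ (1 / (2 * (d : ℝ) - 1)) := by
              gcongr
              norm_num
          _ = 2 * (m : ℝ) ^ (1 / (2 * (d : ℝ) - 1)) := by rw [Real.rpow_one]
    calc 1 / (64 * (d : ℝ)) * ((m : ℝ) ^ ((2 * (d : ℝ) - 2) / (2 * (d : ℝ) - 1)) * (n : ℝ) ^ e)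
        ≤ 1 / 2 * ((m : ℝ) ^ ((2 * (d : ℝ) - 2) / (2 * (d : ℝ) - 1)) *
          (2 * (m : ℝ) ^ (1 / (2 * (d : ℝ) - 1)))) := by
          gcongr
          linarith
      _ = (m : ℝ) ^ ((2 * (d : ℝ) - 2) / (2 * (d : ℝ) - 1) + 1 / (2 * (d : ℝ) - 1)) := by
          rw [Real.rpow_add (by linarith)]
          ring
      _ = m * (1 : ℕ) := by
          rw [h3, sub_add_cancel, Real.rpow_one, Nat.cast_one, mul_one]

theorem Realizes.hasConfiguration_of_le_one {d : ℕ} (hd : 4 ≤ d) {ε : ℝ} (hε : 0 < ε)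
    (hε1 : ε ≤ 1) {m : ℕ} (hm : 1 ≤ m) {F : Set (Set (EuclideanSpace ℝ (Fin d)))}
    (hF : Realizes (d - 1) F) : HasConfiguration d ε (1 / (64 * d)) (64 * d) m F := by
  rcases lt_or_ge ε (1 / 3) with h | h
  · exact hasConfiguration_of_lt_third hd hε h hm hF
  · exact hasConfiguration_of_third_le hd h hε1 hm hF

theorem theorem3 (d : ℕ) (hd : 4 ≤ d) (ε : ℝ) (hε : 0 < ε) (hε1 : ε ≤ 1) :
    ∃ c C : ℝ, 0 < c ∧ 0 < C ∧ ∀ m : ℕ, 1 ≤ m →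
      HasConfiguration d ε c C m {V | IsHyperplane V} ∧
      HasConfiguration d ε c C m {V | IsHypersphere V} ∧
      ∀ F : Set (Set (EuclideanSpace ℝ (Fin d))),
        F.Nonempty → IsLinearlyClosed (lt_of_lt_of_le (by norm_num) hd) F →
          HasConfiguration d ε c C m F := by
  have hd0 : 0 < d := by omega
  refine ⟨1 / (64 * d), 64 * d, by positivity, by positivity, fun m hm => ⟨?_, ?_, ?_⟩⟩
  · exact (realizes_isHyperplane hd0).hasConfiguration_of_le_one hd hε hε1 hm
  · exact (realizes_isHypersphere hd0).hasConfiguration_of_le_one hd hε hε1 hm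
  · exact fun F hne hF =>
      (realizes_of_isLinearlyClosed hd0 hne hF).hasConfiguration_of_le_one hd hε hε1 hm
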